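/- For a finite set $S$ of points in the plane, let $\mathcal{P}(S)$ be the set of all simple polygons (closed regions bounded by a simple closed polygonal chain) whose vertex set equals $S$. A point $g\in P$ sees a point $a\in P$ in a polygon $P$ if the segment $ga$ is contained in $P$. A set $G\subseteq S$ is a guard set for a set $A\subseteq\mathcal{P}(S)$ of polygons if, for every $P\in A$, every point of $P$ is seen in $P$ by some $g\in G$. Let $UG(A)$ be the minimum cardinality of a guard set $G\subseteq S$ for $A$, and let $$UG^k(n)=\max_{S\subset\mathbb{R}^2,\ |S|=n}\ \ \max_{A\subseteq\mathcal{P}(S),\ |A|=k} UG(A)$$ be the $k$-universal guard number for simple polygons. Theorem. There is an absolute constant $N$ such that for every $k\ge 6$ and every $n\ge\max\{N,k\}$, $$UG^k(n)\ \ge\ \left\lfloor \frac{5n}{9}\right\rfloor .$$ In particular, for every $k\ge 6$ this bound holds for all sufficiently large $n$. -/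

import Mathlib

/-- The Euclidean plane. -/
abbrev Plane : Type := EuclideanSpace ℝ (Fin 2)

namespace UniversalGuard

/-- The closed polygonal chain `v₀ v₁ … v₍ₘ₋₁₎ v₀` is simple: it has at least three vertices, the
vertices are pairwise distinct, and two different edges meet at most in a common endpoint.
(A vertex with a straight angle is allowed.) -/
def IsSimple {m : ℕ} (poly : Polygon Plane m) : Prop :=
  3 ≤ m ∧ Function.Injective poly.vertices ∧
    ∀ i j : Fin m, i ≠ j →
      poly.edgeSet ℝ i ∩ poly.edgeSet ℝ j ⊆
        ({poly i, poly (finRotate m i)} : Set Plane) ∩ {poly j, poly (finRotate m j)}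

/-- The closed region bounded by the chain: the chain itself, together with all points that
lie in a bounded connected component of its complement. -/
def region {m : ℕ} (poly : Polygon Plane m) : Set Plane :=
  poly.boundary ℝ ∪
    {x | x ∉ poly.boundary ℝ ∧ Bornology.IsBounded (connectedComponentIn (poly.boundary ℝ)ᶜ x)}

/-- The set `𝒫(S)` of all simple polygons, as closed regions of the plane, whose vertex set
equals `S`. -/
def simplePolygons (S : Finset Plane) : Set (Set Plane) :=
  {P | ∃ (m : ℕ) (poly : Polygon Plane m),
    IsSimple poly ∧ Set.range poly.vertices = (S : Set Plane) ∧ P = region poly}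

/-- The visible region of `g` with respect to `P`: the points `a` of `P` with `ga ⊆ P`. -/
def visibleRegion (P : Set Plane) (g : Plane) : Set Plane :=
  {a | a ∈ P ∧ segment ℝ g a ⊆ P}

/-- `G` is a guard set for the polygon `P`: the visible regions of its points cover `P`. -/
def IsGuardSet (G : Finset Plane) (P : Set Plane) : Prop :=
  ⋃ g ∈ G, visibleRegion P g = P

/-- The minimum cardinality of a set `G ⊆ S` that is a guard set for every polygon in `A`.
(For simple polygons with vertex set `S` such sets exist, `S` itself being one.) -/
noncomputable def guardNumber (S : Finset Plane) (A : Finset (Set Plane)) : ℕ∞ :=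
  ⨅ (G : Finset Plane) (_ : G ⊆ S ∧ ∀ P ∈ A, IsGuardSet G P), (G.card : ℕ∞)

/-- The `k`-universal guard number `UG^k(n)` for simple polygons: the maximum, over all sets `S`
of `n` points of the plane and all sets `A` of exactly `k` simple polygons with vertex set `S`,
of the minimum cardinality of a guard set for `A`. -/
noncomputable def kUniversalGuardNumber (k n : ℕ) : ℕ∞ :=
  ⨆ (S : Finset Plane) (_ : S.card = n) (A : Finset (Set Plane))
    (_ : A.card = k ∧ (A : Set (Set Plane)) ⊆ simplePolygons S), guardNumber S A

end UniversalGuard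

/-! The lower bound comes from a block of seven points with six Hamiltonian paths through it. A path
has tips: vertices `b` at which the polygon has a convex angle, with no vertices other than `b` and
its two neighbours inside the cone spanned by the two edges at `b`. Only these three vertices can
see `b`, so a guard set contains one of them. The six paths together yield 13 such triples, and no
three of the seven points meet them all (`four_le_card_of_hits`). Hence a set guarding six suitable
polygons has at least four points in each block.

Copies of the block are placed far apart on a horizontal line, traversed from left to right and
closed up from below; at most ten further vertices adjust the total number. This gives `4 * m`
guards for `n ≤ 7 * m + 10` points, and `4 / 7 > 5 / 9` leaves room for the constant.

Invisibility (`not_segment_subset_region`) needs no Jordan curve theorem. From each tip a leg leads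
to a waypoint, from which a vertical ray escapes to infinity without meeting the boundary. If `g` is
outside the cone, this route, moved slightly from `b` towards `g`, misses the whole boundary, so
points of the segment `gb` close to `b` are exterior.

All geometry inside a block and towards its neighbours is a finite check of integer orientations.
For `k > 6` the six polygons are supplemented by others on the same vertices, of which independent
choices in the blocks give `2 ^ m` (`region_binaryTypes_injective`); more polygons never lower the
guard number. -/

namespace UniversalGuard

/-! ### Integer points and segments between them -/

/-- The point of the plane with the given integer coordinates. -/
noncomputable def toPlane (p : ℤ × ℤ) : Plane := !₂[(p.1 : ℝ), (p.2 : ℝ)]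

@[simp] lemma toPlane_zero (p : ℤ × ℤ) : toPlane p 0 = p.1 := rfl

@[simp] lemma toPlane_one (p : ℤ × ℤ) : toPlane p 1 = p.2 := rfl

lemma toPlane_injective : Function.Injective toPlane := by
  intro p q h
  have h0 := congrArg (fun z : Plane => z 0) h
  have h1 := congrArg (fun z : Plane => z 1) h
  simp only [toPlane_zero, toPlane_one, Int.cast_inj] at h0 h1
  exact Prod.ext h0 h1

/-- The value at `z` of the linear functional with integer coefficients `a`, `b`. -/
def functional (a b : ℤ) (z : Plane) : ℝ := a * z 0 + b * z 1

lemma functional_add (a b : ℤ) (x y : Plane) :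
    functional a b (x + y) = functional a b x + functional a b y := by
  simp only [functional, PiLp.add_apply]; ring

lemma functional_smul (a b : ℤ) (c : ℝ) (x : Plane) :
    functional a b (c • x) = c * functional a b x := by
  simp only [functional, PiLp.smul_apply, smul_eq_mul]; ring

lemma functional_toPlane (a b : ℤ) (p : ℤ × ℤ) :
    functional a b (toPlane p) = ((a * p.1 + b * p.2 : ℤ) : ℝ) := by
  simp [functional]

/-- Two segments between integer points meet at most in common endpoints. -/
def NoCross (p q r s : ℤ × ℤ) : Prop :=
  segment ℝ (toPlane p) (toPlane q) ∩ segment ℝ (toPlane r) (toPlane s) ⊆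
    {toPlane p, toPlane q} ∩ {toPlane r, toPlane s}

lemma NoCross.symm {p q r s : ℤ × ℤ} (h : NoCross p q r s) : NoCross r s p q := by
  rintro x ⟨h1, h2⟩
  exact (h ⟨h2, h1⟩).symm

lemma functional_lt_of_mem_segment {a b : ℤ} {c : ℝ} {x y z : Plane} (hz : z ∈ segment ℝ x y)
    (hx : functional a b x < c) (hy : functional a b y < c) : functional a b z < c := by
  obtain ⟨s, t, hs, ht, hst, rfl⟩ := hz
  rw [functional_add, functional_smul, functional_smul]
  rcases hs.eq_or_lt with rfl | hs
  · obtain rfl : t = 1 := by linarith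
    linarith
  · calc _ < s * c + t * c :=
          add_lt_add_of_lt_of_le (by gcongr) (mul_le_mul_of_nonneg_left hy.le ht)
      _ = c := by rw [← add_mul, hst, one_mul]

lemma functional_le_of_mem_segment {a b : ℤ} {c : ℝ} {x y z : Plane} (hz : z ∈ segment ℝ x y)
    (hx : functional a b x ≤ c) (hy : functional a b y ≤ c) : functional a b z ≤ c := by
  obtain ⟨s, t, hs, ht, hst, rfl⟩ := hz
  rw [functional_add, functional_smul, functional_smul]
  calc _ ≤ s * c + t * c := by gcongr
    _ = c := by rw [← add_mul, hst, one_mul]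

lemma functional_neg (a b : ℤ) (z : Plane) : functional (-a) (-b) z = -functional a b z := by
  simp only [functional]; push_cast; ring

lemma le_functional_of_mem_segment {a b : ℤ} {c : ℝ} {x y z : Plane} (hz : z ∈ segment ℝ x y)
    (hx : c ≤ functional a b x) (hy : c ≤ functional a b y) : c ≤ functional a b z := by
  have := functional_le_of_mem_segment (a := -a) (b := -b) (c := -c) hz
    (by rw [functional_neg]; linarith) (by rw [functional_neg]; linarith)
  rw [functional_neg] at this
  linarith

/-- Separation by a line with integer coefficients turns disjointness into four integer
inequalities, accessible to `omega` and `decide`. -/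
lemma disjoint_segment_of_lt (a b c : ℤ) {p q r s : ℤ × ℤ}
    (hp : a * p.1 + b * p.2 < c) (hq : a * q.1 + b * q.2 < c)
    (hr : c ≤ a * r.1 + b * r.2) (hs : c ≤ a * s.1 + b * s.2) :
    Disjoint (segment ℝ (toPlane p) (toPlane q)) (segment ℝ (toPlane r) (toPlane s)) := by
  rw [Set.disjoint_left]
  intro x hx hx'
  have h1 : functional a b x < c := functional_lt_of_mem_segment hx
    (by rw [functional_toPlane]; exact_mod_cast hp) (by rw [functional_toPlane]; exact_mod_cast hq)
  have h2 : (c : ℝ) ≤ functional a b x := le_functional_of_mem_segment hx'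
    (by rw [functional_toPlane]; exact_mod_cast hr) (by rw [functional_toPlane]; exact_mod_cast hs)
  linarith

lemma noCross_of_disjoint {p q r s : ℤ × ℤ}
    (h : Disjoint (segment ℝ (toPlane p) (toPlane q)) (segment ℝ (toPlane r) (toPlane s))) :
    NoCross p q r s := by
  rw [NoCross, h.inter_eq]
  exact Set.empty_subset _

lemma noCross_of_lt (a b c : ℤ) {p q r s : ℤ × ℤ}
    (hp : a * p.1 + b * p.2 < c) (hq : a * q.1 + b * q.2 < c)
    (hr : c ≤ a * r.1 + b * r.2) (hs : c ≤ a * s.1 + b * s.2) : NoCross p q r s :=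
  noCross_of_disjoint (disjoint_segment_of_lt a b c hp hq hr hs)

lemma eq_right_of_mem_segment {a b : ℤ} {x y z : Plane} (hz : z ∈ segment ℝ x y)
    (hxy : functional a b x < functional a b y) (h : functional a b y ≤ functional a b z) :
    z = y := by
  obtain ⟨s, t, hs, ht, hst, rfl⟩ := hz
  rw [functional_add, functional_smul, functional_smul] at h
  obtain rfl : t = 1 - s := by linarith
  have hs0 : s = 0 := by
    by_contra hne
    have : 0 < s := lt_of_le_of_ne hs (Ne.symm hne)
    nlinarith
  subst hs0
  simp

/-- Consecutive segments on which some linear functional increases meet in one point only. -/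
lemma noCross_touch (a b : ℤ) {p q s : ℤ × ℤ}
    (hp : a * p.1 + b * p.2 < a * q.1 + b * q.2)
    (hs : a * q.1 + b * q.2 < a * s.1 + b * s.2) : NoCross p q q s := by
  rintro x ⟨hx, hx'⟩
  have hp' : functional a b (toPlane p) < functional a b (toPlane q) := by
    rw [functional_toPlane, functional_toPlane]; exact_mod_cast hp
  have hs' : functional a b (toPlane q) < functional a b (toPlane s) := by
    rw [functional_toPlane, functional_toPlane]; exact_mod_cast hs
  have hxq : functional a b (toPlane q) ≤ functional a b x :=
    le_functional_of_mem_segment hx' le_rfl hs'.le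
  obtain rfl := eq_right_of_mem_segment hx hp' hxq
  simp

/-! ### Orientation tests -/

/-- Twice the signed area of a triangle. -/
def orient (p q r : ℤ × ℤ) : ℤ := (q.1 - p.1) * (r.2 - p.2) - (q.2 - p.2) * (r.1 - p.1)

/-- The points `r` and `s` lie strictly on the same side of the line `pq`. -/
def SameSide (p q r s : ℤ × ℤ) : Prop :=
  (0 < orient p q r ∧ 0 < orient p q s) ∨ (orient p q r < 0 ∧ orient p q s < 0)

/-- One of the segments `pq`, `rs` lies strictly on one side of the line through the other. -/
def Apart (p q r s : ℤ × ℤ) : Prop := SameSide p q r s ∨ SameSide r s p q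

/-- The vertical ray going up from `w` misses the segment `pq`, for one of the obvious reasons. -/
def ClearAbove (w p q : ℤ × ℤ) : Prop :=
  (p.1 < w.1 ∧ q.1 < w.1) ∨ (w.1 < p.1 ∧ w.1 < q.1) ∨
    (p.1 ≤ q.1 ∧ 0 < orient p q w) ∨ (q.1 ≤ p.1 ∧ orient p q w < 0)

instance (p q r s : ℤ × ℤ) : Decidable (SameSide p q r s) := by
  unfold SameSide; infer_instance

instance (p q r s : ℤ × ℤ) : Decidable (Apart p q r s) := by
  unfold Apart; infer_instance

instance (w p q : ℤ × ℤ) : Decidable (ClearAbove w p q) := by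
  unfold ClearAbove; infer_instance

/-- Horizontal translation. -/
def shift (p : ℤ × ℤ) (x : ℤ) : ℤ × ℤ := (p.1 + x, p.2)

@[simp] lemma shift_fst (p : ℤ × ℤ) (x : ℤ) : (shift p x).1 = p.1 + x := rfl

@[simp] lemma shift_snd (p : ℤ × ℤ) (x : ℤ) : (shift p x).2 = p.2 := rfl

lemma shift_shift (p : ℤ × ℤ) (x y : ℤ) : shift (shift p x) y = shift p (x + y) := by
  simp [shift, add_assoc]

lemma orient_shift (p q r : ℤ × ℤ) (x : ℤ) :
    orient (shift p x) (shift q x) (shift r x) = orient p q r := by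
  simp only [orient, shift_fst, shift_snd]; ring

lemma Apart.shift {p q r s : ℤ × ℤ} (h : Apart p q r s) (x : ℤ) :
    Apart (shift p x) (shift q x) (shift r x) (shift s x) := by
  simpa only [Apart, SameSide, orient_shift] using h

lemma ClearAbove.shift {w p q : ℤ × ℤ} (h : ClearAbove w p q) (x : ℤ) :
    ClearAbove (shift w x) (shift p x) (shift q x) := by
  simpa only [ClearAbove, orient_shift, shift_fst, add_lt_add_iff_right, add_le_add_iff_right]
    using h

lemma SameSide.disjoint {p q r s : ℤ × ℤ} (h : SameSide p q r s) :
    Disjoint (segment ℝ (toPlane p) (toPlane q)) (segment ℝ (toPlane r) (toPlane s)) := by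
  rcases h with ⟨h1, h2⟩ | ⟨h1, h2⟩ <;> simp only [orient] at h1 h2
  -- The functional is the linear part of `orient p q`. By integrality a positive orientation is at
  -- least 1, whence the `+ 1` in the threshold.
  · exact disjoint_segment_of_lt (-(q.2 - p.2)) (q.1 - p.1)
      (-(q.2 - p.2) * p.1 + (q.1 - p.1) * p.2 + 1) (by linarith) (by linarith) (by linarith)
      (by linarith)
  · exact disjoint_segment_of_lt (q.2 - p.2) (-(q.1 - p.1))
      ((q.2 - p.2) * p.1 - (q.1 - p.1) * p.2 + 1) (by linarith) (by linarith) (by linarith)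
      (by linarith)

lemma Apart.disjoint {p q r s : ℤ × ℤ} (h : Apart p q r s) :
    Disjoint (segment ℝ (toPlane p) (toPlane q)) (segment ℝ (toPlane r) (toPlane s)) :=
  h.elim SameSide.disjoint fun h => h.disjoint.symm

lemma Apart.noCross {p q r s : ℤ × ℤ} (h : Apart p q r s) : NoCross p q r s :=
  noCross_of_disjoint h.disjoint

/-- A functional normal to `pq` is constant on `pq`, and with the right sign it attains its maximum
over `qs` only at `q`. -/
lemma noCross_of_orient_ne_zero {p q s : ℤ × ℤ} (h : orient p q s ≠ 0) : NoCross p q q s := by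
  rintro x ⟨hx, hx'⟩
  have hpq (a b : ℤ) (h1 : a * p.1 + b * p.2 = a * q.1 + b * q.2)
      (h2 : a * s.1 + b * s.2 < a * q.1 + b * q.2) : x = toPlane q := by
    refine eq_right_of_mem_segment (a := a) (b := b) (segment_symm ℝ (toPlane q) _ ▸ hx') ?_ ?_
    · rw [functional_toPlane, functional_toPlane]; exact_mod_cast h2
    · refine le_functional_of_mem_segment hx ?_ le_rfl
      rw [functional_toPlane, functional_toPlane, h1]
  have : x = toPlane q := by
    rcases lt_or_gt_of_ne h with h | h <;> simp only [orient] at h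
    · exact hpq (-(q.2 - p.2)) (q.1 - p.1) (by ring) (by linarith)
    · exact hpq (q.2 - p.2) (-(q.1 - p.1)) (by ring) (by linarith)
  simp [this]

/-- The vertical ray going up from `w`. -/
def ray (w : Plane) : Set Plane := {z | z 0 = w 0 ∧ w 1 ≤ z 1}

/-- As `0 ≤ b`, the functional does not decrease along the ray, so separating the starting point
suffices. -/
lemma disjoint_ray_segment (a b c : ℤ) (hb : 0 ≤ b) {w p q : ℤ × ℤ}
    (hp : a * p.1 + b * p.2 < c) (hq : a * q.1 + b * q.2 < c) (hw : c ≤ a * w.1 + b * w.2) :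
    Disjoint (ray (toPlane w)) (segment ℝ (toPlane p) (toPlane q)) := by
  rw [Set.disjoint_left]
  rintro x ⟨hx0, hx1⟩ hx
  have h1 : functional a b x < c := functional_lt_of_mem_segment hx
    (by rw [functional_toPlane]; exact_mod_cast hp) (by rw [functional_toPlane]; exact_mod_cast hq)
  have h2 : (c : ℝ) ≤ functional a b (toPlane w) := by
    rw [functional_toPlane]; exact_mod_cast hw
  have h3 : functional a b (toPlane w) ≤ functional a b x := by
    simp only [functional, hx0]
    have : (0 : ℝ) ≤ b := by exact_mod_cast hb
    gcongr
  linarith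

lemma ClearAbove.disjoint {w p q : ℤ × ℤ} (h : ClearAbove w p q) :
    Disjoint (ray (toPlane w)) (segment ℝ (toPlane p) (toPlane q)) := by
  rcases h with ⟨h1, h2⟩ | ⟨h1, h2⟩ | ⟨h1, h2⟩ | ⟨h1, h2⟩
  · exact disjoint_ray_segment 1 0 w.1 le_rfl (by linarith) (by linarith) (by linarith)
  · exact disjoint_ray_segment (-1) 0 (-w.1) le_rfl (by linarith) (by linarith) (by linarith)
  · simp only [orient] at h2
    exact disjoint_ray_segment (-(q.2 - p.2)) (q.1 - p.1)
      (-(q.2 - p.2) * p.1 + (q.1 - p.1) * p.2 + 1) (by linarith) (by linarith) (by linarith)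
      (by linarith)
  · simp only [orient] at h2
    exact disjoint_ray_segment (q.2 - p.2) (-(q.1 - p.1))
      ((q.2 - p.2) * p.1 - (q.1 - p.1) * p.2 + 1) (by linarith) (by linarith) (by linarith)
      (by linarith)

/-! ### Points outside the region -/

lemma isCompact_segment (x y : Plane) : IsCompact (segment ℝ x y) := by
  rw [segment_eq_image]
  exact isCompact_Icc.image (by fun_prop)

lemma isClosed_ray (w : Plane) : IsClosed (ray w) := by
  have h0 : Continuous fun z : Plane => z 0 := by fun_prop
  have h1 : Continuous fun z : Plane => z 1 := by fun_prop
  exact (isClosed_eq h0 continuous_const).inter (isClosed_le continuous_const h1)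

lemma convex_ray (w : Plane) : Convex ℝ (ray w) := by
  rintro x ⟨hx0, hx1⟩ y ⟨hy0, hy1⟩ a b ha hb hab
  refine ⟨?_, ?_⟩ <;> simp only [PiLp.add_apply, PiLp.smul_apply, smul_eq_mul]
  · rw [hx0, hy0, ← add_mul, hab, one_mul]
  · calc w 1 = a * w 1 + b * w 1 := by rw [← add_mul, hab, one_mul]
      _ ≤ _ := by gcongr

lemma self_mem_ray (w : Plane) : w ∈ ray w := ⟨rfl, le_rfl⟩

lemma not_isBounded_ray (w : Plane) : ¬ Bornology.IsBounded (ray w) := by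
  intro h
  obtain ⟨C, hC⟩ := h.exists_norm_le
  have hm : (!₂[w 0, max (w 1) (C + 1)] : Plane) ∈ ray w := ⟨rfl, le_max_left _ _⟩
  have h1 := hC _ hm
  have h2 := PiLp.norm_apply_le (p := 2) (!₂[w 0, max (w 1) (C + 1)] : Plane) 1
  have h3 : max (w 1) (C + 1) ≤ ‖(!₂[w 0, max (w 1) (C + 1)] : Plane) 1‖ := le_abs_self _
  have h4 := le_max_right (w 1) (C + 1)
  linarith

/-- A point joined by a segment to a vertical ray, all of it missing the boundary, is not in the
region. -/
lemma not_mem_region_of_escape {n : ℕ} (poly : Polygon Plane n) {x y : Plane}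
    (hxy : Disjoint (segment ℝ x y) (poly.boundary ℝ)) (hy : Disjoint (ray y) (poly.boundary ℝ)) :
    x ∉ region poly := by
  have hx : x ∉ poly.boundary ℝ := Set.disjoint_left.1 hxy (left_mem_segment ℝ x y)
  rintro (h | ⟨-, h⟩)
  · exact hx h
  · have hconn : IsPreconnected (segment ℝ x y ∪ ray y) :=
      IsPreconnected.union y (right_mem_segment ℝ x y) (self_mem_ray y)
        (convex_segment x y).isPreconnected (convex_ray y).isPreconnected
    have hsub := hconn.subset_connectedComponentIn (x := x) (F := (poly.boundary ℝ)ᶜ)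
      (Or.inl (left_mem_segment ℝ x y))
      (Set.subset_compl_iff_disjoint_right.2 (hxy.union_left hy))
    exact not_isBounded_ray y (h.subset (Set.subset_union_right.trans hsub))

/-- Let `b` be a boundary point, let the boundary consist of a part on which the functional
`functional α β` is at least its value at `b`, and of a closed part missing the segment `bw`, and
let the ray above `w` miss the boundary. Then `b` is not seen by any point at which the functional
is smaller. -/
lemma not_segment_subset_region {n : ℕ} (poly : Polygon Plane n) {F₁ F₂ : Set Plane}
    (hF : poly.boundary ℝ ⊆ F₁ ∪ F₂) (hcomp : IsCompact (poly.boundary ℝ)) (hF₂ : IsClosed F₂)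
    {b w g : Plane} {α β : ℤ} (hF₁ : ∀ z ∈ F₁, functional α β b ≤ functional α β z)
    (hg : functional α β g < functional α β b) (hw : functional α β w ≤ functional α β b)
    (hleg : Disjoint (segment ℝ b w) F₂) (hray : Disjoint (ray w) (poly.boundary ℝ)) :
    ¬ segment ℝ g b ⊆ region poly := by
  -- Compactness gives the leg and the ray positive distance from what they miss, so both tolerate a
  -- small translation.
  obtain ⟨δ₁, hδ₁, h₁⟩ := hleg.exists_thickenings (isCompact_segment b w) hF₂
  obtain ⟨δ₂, hδ₂, h₂⟩ := hray.symm.exists_thickenings hcomp (isClosed_ray w)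
  set v : Plane := g - b with hv
  have hvb : functional α β v < 0 := by
    have : functional α β g = functional α β v + functional α β b := by
      rw [← functional_add, hv, sub_add_cancel]
    linarith
  obtain ⟨ε, hε0, hε1, hε₁, hε₂⟩ : ∃ ε : ℝ, 0 < ε ∧ ε ≤ 1 ∧ ε * ‖v‖ < δ₁ ∧ ε * ‖v‖ < δ₂ := by
    refine ⟨min 1 (min δ₁ δ₂ / (‖v‖ + 1)), ?_, min_le_left _ _, ?_, ?_⟩
    · have := lt_min hδ₁ hδ₂
      positivity
    all_goals
      have hd := lt_min hδ₁ hδ₂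
      calc min 1 (min δ₁ δ₂ / (‖v‖ + 1)) * ‖v‖ ≤ min δ₁ δ₂ / (‖v‖ + 1) * ‖v‖ := by
            gcongr; exact min_le_right _ _
        _ < min δ₁ δ₂ / (‖v‖ + 1) * (‖v‖ + 1) := by
            gcongr; linarith
        _ = min δ₁ δ₂ := by field_simp
        _ ≤ _ := by first | exact min_le_left _ _ | exact min_le_right _ _
  have hdist (z : Plane) : dist (z + ε • v) z = ε * ‖v‖ := by
    rw [dist_eq_norm, add_sub_cancel_left, norm_smul, Real.norm_of_nonneg hε0.le]
  intro hsub
  refine not_mem_region_of_escape poly (x := b + ε • v) (y := w + ε • v) ?_ ?_ (hsub ?_)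
  · rw [Set.disjoint_left]
    rintro z ⟨s, t, hs, ht, hst, rfl⟩ hz
    have hz' : s • (b + ε • v) + t • (w + ε • v) = (s • b + t • w) + ε • v := by
      obtain rfl : t = 1 - s := by linarith
      module
    rw [hz'] at hz
    have hm : s • b + t • w ∈ segment ℝ b w := ⟨s, t, hs, ht, hst, rfl⟩
    -- Near `b` distance is of no help: `F₁` may contain `b`. There the translation strictly lowers
    -- the functional below its minimum on `F₁`.
    rcases hF hz with hz | hz
    · have h3 := hF₁ _ hz
      have h4 := functional_le_of_mem_segment hm le_rfl hw
      rw [functional_add, functional_smul] at h3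
      nlinarith
    · refine Set.disjoint_left.1 h₁ (Metric.mem_thickening_iff.2 ⟨_, hm, ?_⟩)
        (Metric.self_subset_thickening hδ₁ _ hz)
      rw [hdist]; exact hε₁
  · rw [Set.disjoint_left]
    rintro z ⟨hz0, hz1⟩ hz
    refine Set.disjoint_left.1 h₂ (Metric.self_subset_thickening hδ₂ _ hz)
      (Metric.mem_thickening_iff.2 ⟨z - ε • v, ⟨?_, ?_⟩, ?_⟩)
    · simp only [PiLp.sub_apply, PiLp.add_apply] at hz0 ⊢; linarith
    · simp only [PiLp.sub_apply, PiLp.add_apply] at hz1 ⊢; linarith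
    · have := hdist (z - ε • v)
      rw [sub_add_cancel] at this
      rw [this]; exact hε₂
  · refine ⟨ε, 1 - ε, hε0.le, by linarith, by ring, ?_⟩
    rw [hv]; module

/-! ### The block of seven points -/

/-- The seven points of a block. -/
def blockPoint : Fin 7 → ℤ × ℤ :=
  ![(18, 21), (6, 32), (25, 22), (13, 39), (36, 18), (12, 9), (5, 27)]

/-- Six orders in which a polygon may traverse the points of a block. -/
def order : Fin 6 → Fin 7 → Fin 7 :=
  ![![5, 6, 0, 1, 2, 3, 4], ![6, 1, 5, 0, 3, 2, 4], ![3, 2, 1, 6, 4, 0, 5],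
    ![3, 4, 1, 2, 6, 0, 5], ![3, 0, 1, 6, 5, 2, 4], ![1, 6, 3, 5, 0, 4, 2]]

/-- The `j`-th point on the path of type `t` through a block. -/
def pathPoint (t : Fin 6) (j : Fin 7) : ℤ × ℤ := blockPoint (order t j)

/-- The first point of the path of the given type; `none` stands for a single point. -/
def firstPoint : Option (Fin 6) → ℤ × ℤ
  | none => (0, 20)
  | some t => pathPoint t 0

/-- The last point of the path of the given type; `none` stands for a single point. -/
def lastPoint : Option (Fin 6) → ℤ × ℤ
  | none => (0, 20)
  | some t => pathPoint t 6

/-- The distance of consecutive blocks. -/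
abbrev spacing : ℤ := 1000000

/-- The tips of the paths that are seen from their two neighbours only: the type of the path, the
position `j + 1` on the path, and a point from which a vertical ray leaves. -/
def tips : List (Fin 6 × Fin 5 × ℤ × ℤ) :=
  [(0, 0, 4, 28), (0, 2, 3, 34), (0, 4, 12, 40), (1, 0, 6, 33), (1, 3, 12, 41), (2, 0, 26, 21),
    (2, 3, 40, 17), (3, 0, 38, 17), (3, 2, 37, 17), (4, 0, 19, 20), (4, 4, 25, 23), (5, 1, 14, 41),
    (5, 3, 18, 22)]

lemma blockPoint_injective : Function.Injective blockPoint := by decide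

lemma order_bijective : ∀ t, Function.Bijective (order t) := by decide

lemma blockPoint_bounds : ∀ a, 0 ≤ (blockPoint a).1 ∧ (blockPoint a).1 ≤ 36 ∧
    0 ≤ (blockPoint a).2 ∧ (blockPoint a).2 ≤ 39 := by decide

lemma pathPoint_bounds (t : Fin 6) (j : Fin 7) : 0 ≤ (pathPoint t j).1 ∧ (pathPoint t j).1 ≤ 36 ∧
    0 ≤ (pathPoint t j).2 ∧ (pathPoint t j).2 ≤ 39 := blockPoint_bounds _

lemma firstPoint_bounds (u : Option (Fin 6)) : 0 ≤ (firstPoint u).1 ∧ (firstPoint u).1 ≤ 36 ∧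
    0 ≤ (firstPoint u).2 ∧ (firstPoint u).2 ≤ 39 := by
  cases u
  · simp [firstPoint]
  · exact blockPoint_bounds _

lemma lastPoint_bounds (u : Option (Fin 6)) : 0 ≤ (lastPoint u).1 ∧ (lastPoint u).1 ≤ 36 ∧
    0 ≤ (lastPoint u).2 ∧ (lastPoint u).2 ≤ 39 := by
  cases u
  · simp [lastPoint]
  · exact blockPoint_bounds _

/-! ### Finite checks for simplicity -/

lemma apart_inner : ∀ t, ∀ i j : Fin 6, i.val + 1 < j.val →
    Apart (pathPoint t i.castSucc) (pathPoint t i.succ) (pathPoint t j.castSucc)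
      (pathPoint t j.succ) := by decide +kernel

lemma orient_inner : ∀ t, ∀ i : Fin 5,
    orient (pathPoint t i.castSucc.castSucc) (pathPoint t i.castSucc.succ)
      (pathPoint t i.succ.succ) ≠ 0 := by decide +kernel

/-- In the coordinates of one block, the far end of a link is one of seven points: `u` runs through
the types of the next path and the single end point. -/
lemma apart_outgoing : ∀ t u, ∀ j : Fin 5,
    Apart (pathPoint t j.castSucc.castSucc) (pathPoint t j.castSucc.succ)
      (lastPoint (some t)) (shift (firstPoint u) spacing) := by decide +kernel

lemma orient_outgoing : ∀ t u,
    orient (pathPoint t 5) (pathPoint t 6) (shift (firstPoint u) spacing) ≠ 0 := by decide +kernel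

lemma apart_incoming : ∀ t u, ∀ j : Fin 5,
    Apart (shift (lastPoint u) (-spacing)) (firstPoint (some t))
      (pathPoint t j.succ.castSucc) (pathPoint t j.succ.succ) := by decide +kernel

lemma orient_incoming : ∀ t u,
    orient (shift (lastPoint u) (-spacing)) (pathPoint t 0) (pathPoint t 1) ≠ 0 := by decide +kernel

lemma apart_incoming_outgoing : ∀ t u v,
    Apart (shift (lastPoint u) (-spacing)) (firstPoint (some t)) (lastPoint (some t))
      (shift (firstPoint v) spacing) := by
  decide +kernel

/-- The coefficients of the linear part of `z ↦ orient p q z`. -/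
def normal (p q : ℤ × ℤ) : ℤ × ℤ := (-(q.2 - p.2), q.1 - p.1)

/-- The point at position `j` on the path of type `t`. -/
abbrev prevPoint (t : Fin 6) (j : Fin 5) : ℤ × ℤ := pathPoint t j.castSucc.castSucc

/-- The point at position `j + 1` on the path of type `t`. -/
abbrev tipPoint (t : Fin 6) (j : Fin 5) : ℤ × ℤ := pathPoint t j.succ.castSucc

/-- The point at position `j + 2` on the path of type `t`. -/
abbrev nextPoint (t : Fin 6) (j : Fin 5) : ℤ × ℤ := pathPoint t j.succ.succ

/-- The two functionals bounding the cone of a tip. -/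
def coneNormals (t : Fin 6) (j : Fin 5) : List (ℤ × ℤ) :=
  [normal (tipPoint t j) (prevPoint t j), normal (nextPoint t j) (tipPoint t j)]

/-! ### Finite checks for cones and escape routes of the tips -/

lemma cone_neighbours : ∀ e ∈ tips, ∀ v ∈ coneNormals e.1 e.2.1,
    v.1 * (tipPoint e.1 e.2.1).1 + v.2 * (tipPoint e.1 e.2.1).2 ≤
      v.1 * (prevPoint e.1 e.2.1).1 + v.2 * (prevPoint e.1 e.2.1).2 ∧
    v.1 * (tipPoint e.1 e.2.1).1 + v.2 * (tipPoint e.1 e.2.1).2 ≤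
      v.1 * (nextPoint e.1 e.2.1).1 + v.2 * (nextPoint e.1 e.2.1).2 ∧
    v.1 * e.2.2.1 + v.2 * e.2.2.2 ≤
      v.1 * (tipPoint e.1 e.2.1).1 + v.2 * (tipPoint e.1 e.2.1).2 ∧
    |v.2| ≤ 40 := by decide +kernel

lemma cone_block : ∀ e ∈ tips, ∀ a, a ≠ order e.1 e.2.1.castSucc.castSucc →
    a ≠ order e.1 e.2.1.succ.castSucc → a ≠ order e.1 e.2.1.succ.succ →
    ∃ v ∈ coneNormals e.1 e.2.1, v.1 * (blockPoint a).1 + v.2 * (blockPoint a).2 <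
      v.1 * (tipPoint e.1 e.2.1).1 + v.2 * (tipPoint e.1 e.2.1).2 := by decide +kernel

/-- At distances comparable to `spacing` the horizontal term dominates, so the sign of the first
coefficient alone excludes all points far to the right; `cone_left` does the same on the left. -/
lemma cone_right : ∀ e ∈ tips, ∃ v ∈ coneNormals e.1 e.2.1, v.1 < 0 := by decide +kernel

lemma cone_left : ∀ e ∈ tips, ∃ v ∈ coneNormals e.1 e.2.1, 0 < v.1 := by decide +kernel

lemma waypoint_bounds : ∀ e ∈ tips, 0 ≤ e.2.2.1 ∧ e.2.2.1 ≤ 40 ∧ 0 ≤ e.2.2.2 := by decide +kernel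

lemma clear_inner : ∀ e ∈ tips, ∀ i : Fin 6,
    ClearAbove e.2.2 (pathPoint e.1 i.castSucc) (pathPoint e.1 i.succ) := by decide +kernel

lemma clear_outgoing : ∀ e ∈ tips, ∀ u,
    ClearAbove e.2.2 (lastPoint (some e.1)) (shift (firstPoint u) spacing) := by decide +kernel

lemma clear_incoming : ∀ e ∈ tips, ∀ u,
    ClearAbove e.2.2 (shift (lastPoint u) (-spacing)) (firstPoint (some e.1)) := by decide +kernel

lemma leg_inner : ∀ e ∈ tips, ∀ i : Fin 6, i ≠ e.2.1.castSucc → i ≠ e.2.1.succ →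
    Apart (tipPoint e.1 e.2.1) e.2.2 (pathPoint e.1 i.castSucc) (pathPoint e.1 i.succ) := by
  decide +kernel

lemma leg_outgoing : ∀ e ∈ tips, ∀ u,
    Apart (tipPoint e.1 e.2.1) e.2.2 (lastPoint (some e.1)) (shift (firstPoint u) spacing) := by
  decide +kernel

lemma leg_incoming : ∀ e ∈ tips, ∀ u,
    Apart (tipPoint e.1 e.2.1) e.2.2 (shift (lastPoint u) (-spacing)) (firstPoint (some e.1)) := by
  decide +kernel

/-- A set of points of a block that meets all triples of a tip and its neighbours has at least four
elements. -/
lemma four_le_card_of_hits : ∀ s : Finset (Fin 7),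
    (∀ e ∈ tips, order e.1 e.2.1.castSucc.castSucc ∈ s ∨ order e.1 e.2.1.succ.castSucc ∈ s ∨
      order e.1 e.2.1.succ.succ ∈ s) → 4 ≤ s.card := by decide +kernel

/-! ### The polygons -/

/-- The type of the path to the left of the `i`-th link between blocks. -/
def gate (m : ℕ) (τ : ℕ → Fin 6) : ℕ → Option (Fin 6)
  | 0 => none
  | i + 1 => if i < m then some (τ i) else none

lemma gate_succ {m : ℕ} (τ : ℕ → Fin 6) {i : ℕ} (hi : i < m) : gate m τ (i + 1) = some (τ i) :=
  if_pos hi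

/-- The vertices of a polygon that traverses the blocks `0, …, m - 1` from left to right, the
`i`-th one along a path of type `τ i`, and that returns below them. -/
def vertex (m q : ℕ) (τ : ℕ → Fin 6) (k : ℕ) : ℤ × ℤ :=
  if k = 0 then (0, 20)
  else if k ≤ 7 * m then
    shift (pathPoint (τ ((k - 1) / 7)) (Fin.ofNat 7 (k - 1))) (spacing * (((k - 1) / 7 : ℕ) + 1))
  else if k = 7 * m + 1 then (spacing * (m + 1), 20)
  else (if k = 7 * m + 2 then spacing * (m + 1) else 0, 20 - 40 * (q - (k - (7 * m + 2) : ℕ)))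

/-- The edges of the polygon, with their numbers. -/
inductive IsEdge (m q : ℕ) (τ : ℕ → Fin 6) : ℕ → ℤ × ℤ → ℤ × ℤ → Prop
  | inner (i : ℕ) (j : Fin 6) (hi : i < m) : IsEdge m q τ (7 * i + 1 + j)
      (shift (pathPoint (τ i) j.castSucc) (spacing * (i + 1)))
      (shift (pathPoint (τ i) j.succ) (spacing * (i + 1)))
  | link (i : ℕ) (hi : i ≤ m) : IsEdge m q τ (7 * i)
      (shift (lastPoint (gate m τ i)) (spacing * i))
      (shift (firstPoint (gate m τ (i + 1))) (spacing * (i + 1)))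
  | drop : IsEdge m q τ (7 * m + 1) (spacing * (m + 1), 20) (spacing * (m + 1), 20 - 40 * q)
  | floor : IsEdge m q τ (7 * m + 2) (spacing * (m + 1), 20 - 40 * q) (0, 20 - 40 * (q - 1))
  | column (s : ℕ) (hs : 1 ≤ s) (hsq : s < q) : IsEdge m q τ (7 * m + 2 + s)
      (0, 20 - 40 * (q - s)) (0, 20 - 40 * (q - s - 1))

lemma vertex_zero (m q : ℕ) (τ : ℕ → Fin 6) : vertex m q τ 0 = (0, 20) := if_pos rfl

lemma vertex_block {m : ℕ} (q : ℕ) (τ : ℕ → Fin 6) {i : ℕ} (hi : i < m) (j : Fin 7) :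
    vertex m q τ (7 * i + 1 + j) = shift (pathPoint (τ i) j) (spacing * (i + 1)) := by
  have hj := j.isLt
  have h1 : (7 * i + 1 + j - 1) / 7 = i := by omega
  have h2 : Fin.ofNat 7 (7 * i + 1 + j - 1) = j := by
    apply Fin.ext
    simp only [Fin.ofNat]
    omega
  rw [vertex, if_neg (by omega), if_pos (by omega), h1, h2]

lemma vertex_right (m q : ℕ) (τ : ℕ → Fin 6) :
    vertex m q τ (7 * m + 1) = (spacing * (m + 1), 20) := by
  rw [vertex, if_neg (by omega), if_neg (by omega), if_pos rfl]

lemma vertex_corner (m q : ℕ) (τ : ℕ → Fin 6) :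
    vertex m q τ (7 * m + 2) = (spacing * (m + 1), 20 - 40 * (q : ℤ)) := by
  rw [vertex, if_neg (by omega), if_neg (by omega), if_neg (by omega), if_pos rfl]
  simp

lemma vertex_column (m q : ℕ) (τ : ℕ → Fin 6) {s : ℕ} (hs : 1 ≤ s) :
    vertex m q τ (7 * m + 2 + s) = (0, 20 - 40 * ((q : ℤ) - s)) := by
  rw [vertex, if_neg (by omega), if_neg (by omega), if_neg (by omega), if_neg (by omega)]
  simp

lemma vertex_link_start {m : ℕ} (q : ℕ) (τ : ℕ → Fin 6) {i : ℕ} (hi : i ≤ m) :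
    vertex m q τ (7 * i) = shift (lastPoint (gate m τ i)) (spacing * i) := by
  cases i with
  | zero => simp [vertex_zero, gate, lastPoint, shift]
  | succ i =>
    rw [gate_succ τ (by omega), show 7 * (i + 1) = 7 * i + 1 + (6 : Fin 7) from rfl,
      vertex_block q τ (by omega)]
    push_cast
    rfl

lemma vertex_link_end {m : ℕ} (q : ℕ) (τ : ℕ → Fin 6) {i : ℕ} (hi : i ≤ m) :
    vertex m q τ (7 * i + 1) = shift (firstPoint (gate m τ (i + 1))) (spacing * (i + 1)) := by
  rcases hi.lt_or_eq with hi | rfl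
  · rw [gate_succ τ hi, show 7 * i + 1 = 7 * i + 1 + (0 : Fin 7) from rfl, vertex_block q τ hi]
    rfl
  · rw [vertex_right]
    simp [gate, firstPoint, shift]

lemma isEdge_vertex (m : ℕ) {q : ℕ} (τ : ℕ → Fin 6) {k : ℕ} (hk : k < 7 * m + 2 + q) :
    IsEdge m q τ k (vertex m q τ k) (vertex m q τ (k + 1)) := by
  rcases lt_trichotomy k (7 * m + 1) with h | rfl | h
  · obtain ⟨i, hi⟩ : ∃ i, i = k / 7 := ⟨_, rfl⟩
    rcases Nat.eq_zero_or_pos (k % 7) with h0 | h0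
    · obtain rfl : k = 7 * i := by omega
      rw [vertex_link_start q τ (by omega), vertex_link_end q τ (by omega)]
      exact .link i (by omega)
    · obtain ⟨j, hj⟩ : ∃ j : Fin 6, k = 7 * i + 1 + j :=
        ⟨⟨k % 7 - 1, by omega⟩, by simp only; omega⟩
      subst hj
      have hm : i < m := by omega
      have h1 := vertex_block q τ hm j.castSucc
      have h2 := vertex_block q τ hm j.succ
      rw [Fin.val_castSucc] at h1
      rw [Fin.val_succ, ← add_assoc] at h2
      rw [h1, h2]
      exact .inner i j hm
  · rw [vertex_right, vertex_corner]
    exact .drop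
  · obtain ⟨s, rfl⟩ : ∃ s, k = 7 * m + 2 + s := ⟨k - (7 * m + 2), by omega⟩
    rw [add_assoc _ s 1, vertex_column m q τ (by omega : 1 ≤ s + 1)]
    rcases Nat.eq_zero_or_pos s with rfl | hs
    · rw [add_zero, vertex_corner]
      simpa using IsEdge.floor
    · rw [vertex_column m q τ hs]
      push_cast
      rw [← sub_sub]
      exact .column s hs (by omega)

/-- Step `q` of the column would be the starting point `(0, 20)`, so the column contributes only `q
- 1` new vertices. -/
lemma vertex_last (m : ℕ) {q : ℕ} (hq : 2 ≤ q) (τ : ℕ → Fin 6) :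
    vertex m q τ (7 * m + 2 + q) = vertex m q τ 0 := by
  rw [vertex_column m q τ (by omega), vertex_zero]
  simp

/-! ### Simplicity -/

section

variable {m q : ℕ} {τ : ℕ → Fin 6}

/-- This and `outgoing_eq` write a link in the coordinates of the block at one of its ends, where
the finite checks apply. -/
lemma incoming_eq (i : ℕ) : shift (lastPoint (gate m τ i)) (spacing * i) =
    shift (shift (lastPoint (gate m τ i)) (-spacing)) (spacing * (i + 1)) := by
  rw [shift_shift, show -spacing + spacing * ((i : ℤ) + 1) = spacing * i by ring]

lemma outgoing_eq (i : ℕ) : shift (firstPoint (gate m τ (i + 1))) (spacing * (i + 1)) =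
    shift (shift (firstPoint (gate m τ (i + 1))) spacing) (spacing * i) := by
  rw [shift_shift, show spacing + spacing * (i : ℤ) = spacing * (i + 1) by ring]

lemma noCross_inner {i : ℕ} {j j' : Fin 6} (h : j.val < j'.val) (x : ℤ) :
    NoCross (shift (pathPoint (τ i) j.castSucc) x) (shift (pathPoint (τ i) j.succ) x)
      (shift (pathPoint (τ i) j'.castSucc) x) (shift (pathPoint (τ i) j'.succ) x) := by
  rcases Nat.lt_or_ge (j.val + 1) j'.val with h' | h'
  · exact ((apart_inner _ _ _ h').shift x).noCross
  · obtain ⟨k, rfl⟩ : ∃ k : Fin 5, j = k.castSucc :=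
      ⟨⟨j, by omega⟩, rfl⟩
    obtain rfl : j' = k.succ := by
      apply Fin.ext
      simp only [Fin.val_castSucc, Fin.val_succ] at *
      omega
    refine noCross_of_orient_ne_zero ?_
    rw [orient_shift]
    exact orient_inner _ _

lemma noCross_outgoing (t : Fin 6) (u : Option (Fin 6)) (j : Fin 6) (x : ℤ) :
    NoCross (shift (pathPoint t j.castSucc) x) (shift (pathPoint t j.succ) x)
      (shift (lastPoint (some t)) x) (shift (shift (firstPoint u) spacing) x) := by
  rcases Fin.eq_castSucc_or_eq_last j with ⟨k, rfl⟩ | rfl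
  · exact ((apart_outgoing t u k).shift x).noCross
  · refine noCross_of_orient_ne_zero ?_
    rw [orient_shift]
    exact orient_outgoing t u

lemma noCross_incoming (t : Fin 6) (u : Option (Fin 6)) (j : Fin 6) (x : ℤ) :
    NoCross (shift (shift (lastPoint u) (-spacing)) x) (shift (firstPoint (some t)) x)
      (shift (pathPoint t j.castSucc) x) (shift (pathPoint t j.succ) x) := by
  rcases Fin.eq_zero_or_eq_succ j with rfl | ⟨k, rfl⟩
  · refine noCross_of_orient_ne_zero ?_
    rw [orient_shift]
    exact orient_incoming t u
  · exact ((apart_incoming t u k).shift x).noCross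

lemma noCross_inner_link {i j' : ℕ} (j : Fin 6) (hi : i < m) (h : i < j') :
    NoCross (shift (pathPoint (τ i) j.castSucc) (spacing * (i + 1)))
      (shift (pathPoint (τ i) j.succ) (spacing * (i + 1)))
      (shift (lastPoint (gate m τ j')) (spacing * j'))
      (shift (firstPoint (gate m τ (j' + 1))) (spacing * (j' + 1))) := by
  rcases Nat.lt_or_ge (i + 1) j' with h' | h'
  · have h1 := pathPoint_bounds (τ i) j.castSucc
    have h2 := pathPoint_bounds (τ i) j.succ
    have h3 := lastPoint_bounds (gate m τ j')
    have h4 := firstPoint_bounds (gate m τ (j' + 1))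
    refine noCross_of_lt 1 0 (spacing * j') ?_ ?_ ?_ ?_ <;>
      simp only [shift_fst, spacing] <;> omega
  · obtain rfl : j' = i + 1 := by omega
    rw [outgoing_eq, gate_succ τ hi]
    push_cast
    exact noCross_outgoing _ _ _ _

lemma noCross_link_inner {i' i : ℕ} (j : Fin 6) (hi : i < m) (h : i' ≤ i) :
    NoCross (shift (lastPoint (gate m τ i')) (spacing * i'))
      (shift (firstPoint (gate m τ (i' + 1))) (spacing * (i' + 1)))
      (shift (pathPoint (τ i) j.castSucc) (spacing * (i + 1)))
      (shift (pathPoint (τ i) j.succ) (spacing * (i + 1))) := by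
  rcases h.lt_or_eq with h | rfl
  · have h1 := pathPoint_bounds (τ i) j.castSucc
    have h2 := pathPoint_bounds (τ i) j.succ
    have h3 := lastPoint_bounds (gate m τ i')
    have h4 := firstPoint_bounds (gate m τ (i' + 1))
    refine noCross_of_lt 1 0 (spacing * (i + 1)) ?_ ?_ ?_ ?_ <;>
      simp only [shift_fst, spacing] <;> omega
  · rw [incoming_eq, gate_succ τ hi]
    exact noCross_incoming _ _ _ _

lemma noCross_link_link {i i' : ℕ} (hi : i' ≤ m) (h : i < i') :
    NoCross (shift (lastPoint (gate m τ i)) (spacing * i))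
      (shift (firstPoint (gate m τ (i + 1))) (spacing * (i + 1)))
      (shift (lastPoint (gate m τ i')) (spacing * i'))
      (shift (firstPoint (gate m τ (i' + 1))) (spacing * (i' + 1))) := by
  rcases Nat.lt_or_ge (i + 1) i' with h' | h'
  · have h1 := lastPoint_bounds (gate m τ i)
    have h2 := firstPoint_bounds (gate m τ (i + 1))
    have h3 := lastPoint_bounds (gate m τ i')
    have h4 := firstPoint_bounds (gate m τ (i' + 1))
    refine noCross_of_lt 1 0 (spacing * i') ?_ ?_ ?_ ?_ <;>
      simp only [shift_fst, spacing] <;> omega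
  · obtain rfl : i' = i + 1 := by omega
    rw [incoming_eq, outgoing_eq (i + 1), gate_succ τ (by omega)]
    push_cast
    exact ((apart_incoming_outgoing _ _ _).shift _).noCross

/-- Edges far apart are separated by a vertical or horizontal line; the finite checks are needed
only for edges meeting the same block. -/
lemma IsEdge.noCross (hq : 2 ≤ q) (hq' : q ≤ 8) {k l : ℕ} {p p' r r' : ℤ × ℤ}
    (h₁ : IsEdge m q τ k p p') (h₂ : IsEdge m q τ l r r') (hkl : k < l) : NoCross p p' r r' := by
  cases h₁ with
  | inner i j hi =>
    have h1 := pathPoint_bounds (τ i) j.castSucc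
    have h2 := pathPoint_bounds (τ i) j.succ
    cases h₂ with
    | inner i' j' hi' =>
      rcases (show i ≤ i' by omega).lt_or_eq with h | rfl
      · have h3 := pathPoint_bounds (τ i') j'.castSucc
        have h4 := pathPoint_bounds (τ i') j'.succ
        refine noCross_of_lt 1 0 (spacing * (i' + 1)) ?_ ?_ ?_ ?_ <;>
          simp only [shift_fst, spacing] <;> omega
      · exact noCross_inner (by omega) _
    | link i' hi' => exact noCross_inner_link j hi (by omega)
    | drop =>
      refine noCross_of_lt 1 0 (spacing * (m + 1)) ?_ ?_ ?_ ?_ <;>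
        simp only [shift_fst, spacing] <;> omega
    | floor =>
      -- Blocks lie at heights at least 0, and `2 ≤ q` puts both ends of the floor below 0.
      refine noCross_of_lt 0 (-1) 1 ?_ ?_ ?_ ?_ <;> simp only [shift_snd] <;> omega
    | column s hs hsq =>
      refine (noCross_of_lt 1 0 1 ?_ ?_ ?_ ?_).symm <;> simp only [shift_fst, spacing] <;> omega
  | link i hi =>
    have h1 := lastPoint_bounds (gate m τ i)
    have h2 := firstPoint_bounds (gate m τ (i + 1))
    cases h₂ with
    | inner i' j' hi' => exact noCross_link_inner j' hi' (by omega)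
    | link i' hi' => exact noCross_link_link hi' (by omega)
    | drop =>
      rcases hi.lt_or_eq with h | rfl
      · refine noCross_of_lt 1 0 (spacing * (m + 1)) ?_ ?_ ?_ ?_ <;>
          simp only [shift_fst, spacing] <;> omega
      · have hg : firstPoint (gate i τ (i + 1)) = (0, 20) := by simp [gate, firstPoint]
        rw [hg]
        have he : shift ((0, 20) : ℤ × ℤ) (spacing * (i + 1)) = (spacing * (i + 1), 20) := by
          simp [shift]
        rw [he]
        refine noCross_touch 1 (-1) ?_ ?_ <;> simp only [shift_fst, shift_snd, spacing] <;> omega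
    | floor =>
      refine noCross_of_lt 0 (-1) 1 ?_ ?_ ?_ ?_ <;> simp only [shift_snd] <;> omega
    | column s hs hsq =>
      cases i with
      | succ i =>
        refine (noCross_of_lt 1 0 1 ?_ ?_ ?_ ?_).symm <;>
          simp only [shift_fst, spacing] <;> push_cast <;> omega
      | zero =>
        have he : shift (lastPoint (gate m τ 0)) (spacing * (0 : ℕ)) = (0, 20) := by
          simp [shift, gate, lastPoint]
        rw [he]
        rcases (show s + 1 ≤ q by omega).lt_or_eq with h | rfl
        · refine (noCross_of_lt 1 1 20 ?_ ?_ ?_ ?_).symm <;>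
            simp only [shift_fst, shift_snd, spacing, zero_add] at * <;> push_cast <;> omega
        · rw [show (20 - 40 * (((s + 1 : ℕ) : ℤ) - s - 1)) = 20 by push_cast; ring]
          refine (noCross_touch 1 1 ?_ ?_).symm <;>
            simp only [shift_fst, shift_snd, spacing, zero_add] at * <;> push_cast <;> omega
  | drop =>
    cases h₂ with
    | inner i' j' hi' => omega
    | link i' hi' => omega
    | drop => omega
    | floor => refine noCross_touch (-1) (-1) ?_ ?_ <;> simp only [spacing] <;> omega
    | column s hs hsq =>
      refine (noCross_of_lt 1 0 1 ?_ ?_ ?_ ?_).symm <;> simp only [spacing] <;> omega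
  | floor =>
    cases h₂ with
    | inner i' j' hi' => omega
    | link i' hi' => omega
    | drop => omega
    | floor => omega
    | column s hs hsq =>
      rcases hs.lt_or_eq with h | rfl
      · refine noCross_of_lt 0 1 (20 - 40 * (q - s)) ?_ ?_ ?_ ?_ <;> simp only <;> omega
      -- The corner is 40 lower than the first column vertex, so the height increases along the
      -- floor and on up the column.
      · refine noCross_touch 0 1 ?_ ?_ <;> push_cast <;> omega
  | column s hs hsq =>
    cases h₂ with
    | inner i' j' hi' => omega
    | link i' hi' => omega
    | drop => omega
    | floor => omega
    | column s' hs' hsq' =>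
      rcases (show s + 1 ≤ s' by omega).lt_or_eq with h | rfl
      · refine noCross_of_lt 0 1 (20 - 40 * (q - s')) ?_ ?_ ?_ ?_ <;> simp only <;> omega
      · push_cast
        rw [← sub_sub]
        refine noCross_touch 0 1 ?_ ?_ <;> simp only <;> omega

end

/-! ### Simplicity and common vertex set of the block polygons -/

lemma apply_finRotate {α : Type*} {n : ℕ} {f : ℕ → α} (hf : f n = f 0) (k : Fin n) :
    f (finRotate n k) = f (k + 1) := by
  cases n with
  | zero => exact k.elim0
  | succ n =>
    rw [coe_finRotate]
    split_ifs with h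
    · rw [h, Fin.val_last, hf]
    · rfl

/-- The polygon that traverses the `i`-th block along a path of type `τ i`. -/
noncomputable def blockPolygon (m q : ℕ) (τ : ℕ → Fin 6) : Polygon Plane (7 * m + 2 + q) :=
  ⟨fun k => toPlane (vertex m q τ k)⟩

section

variable {m q : ℕ} {τ : ℕ → Fin 6}

lemma blockPolygon_apply (k : Fin (7 * m + 2 + q)) :
    blockPolygon m q τ k = toPlane (vertex m q τ k) := rfl

lemma blockPolygon_finRotate (hq : 2 ≤ q) (k : Fin (7 * m + 2 + q)) :
    blockPolygon m q τ (finRotate _ k) = toPlane (vertex m q τ (k + 1)) := by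
  rw [blockPolygon_apply, apply_finRotate (vertex_last m hq τ)]

lemma edgeSet_blockPolygon (hq : 2 ≤ q) (k : Fin (7 * m + 2 + q)) :
    (blockPolygon m q τ).edgeSet ℝ k =
      segment ℝ (toPlane (vertex m q τ k)) (toPlane (vertex m q τ (k + 1))) := by
  rw [Polygon.edgeSet, affineSegment_eq_segment, blockPolygon_finRotate hq, blockPolygon_apply]

lemma IsEdge.start_ne (hq : 2 ≤ q) {k l : ℕ} {p p' r r' : ℤ × ℤ}
    (h₁ : IsEdge m q τ k p p') (h₂ : IsEdge m q τ l r r') (hkl : k < l) : p ≠ r := by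
  intro hpr
  have hx := congrArg Prod.fst hpr
  have hy := congrArg Prod.snd hpr
  have hpath (i : ℕ) (j j' : Fin 7) (h : j ≠ j') (x : ℤ) :
      shift (pathPoint (τ i) j) x ≠ shift (pathPoint (τ i) j') x := by
    intro he
    refine h ((order_bijective (τ i)).injective (blockPoint_injective ?_))
    have h1 := congrArg Prod.fst he
    have h2 := congrArg Prod.snd he
    simp only [shift_fst, shift_snd, add_left_inj] at h1 h2
    exact Prod.ext h1 h2
  cases h₁ with
  | inner i j hi =>
    have h1 := pathPoint_bounds (τ i) j.castSucc
    cases h₂ with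
    | inner i' j' hi' =>
      rcases (show i ≤ i' by omega).lt_or_eq with h | rfl
      · have h3 := pathPoint_bounds (τ i') j'.castSucc
        simp only [shift_fst, spacing] at hx
        omega
      · refine hpath i _ _ (fun h => ?_) _ hpr
        have := congrArg Fin.val h
        simp only [Fin.val_castSucc] at this
        omega
    | link i' hi' =>
      rcases (show i + 1 ≤ i' by omega).lt_or_eq with h | rfl
      · have h3 := lastPoint_bounds (gate m τ i')
        simp only [shift_fst, spacing] at hx
        omega
      · rw [gate_succ τ hi] at hpr
        push_cast at hpr
        exact hpath i _ _ (Fin.castSucc_lt_last j).ne _ hpr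
    | drop => simp only [shift_fst, spacing] at hx; omega
    | floor => simp only [shift_fst, spacing] at hx; omega
    | column s hs hsq => simp only [shift_fst, spacing] at hx; omega
  | link i hi =>
    have h1 := lastPoint_bounds (gate m τ i)
    cases h₂ with
    | inner i' j' hi' =>
      have h3 := pathPoint_bounds (τ i') j'.castSucc
      simp only [shift_fst, spacing] at hx
      omega
    | link i' hi' =>
      have h3 := lastPoint_bounds (gate m τ i')
      simp only [shift_fst, spacing] at hx
      omega
    | drop => simp only [shift_fst, spacing] at hx; omega
    | floor => simp only [shift_fst, spacing] at hx; omega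
    | column s hs hsq =>
      cases i with
      | zero =>
        simp only [gate, lastPoint, shift_snd] at hy
        omega
      | succ i =>
        simp only [shift_fst, spacing] at hx
        omega
  | drop => cases h₂ <;> simp only [shift_fst, spacing] at hx hy <;> omega
  | floor => cases h₂ <;> simp only [shift_fst, spacing] at hx hy <;> omega
  | column s hs hsq => cases h₂ <;> simp only [shift_fst, spacing] at hx hy <;> omega

lemma vertex_injOn (hq : 2 ≤ q) : Set.InjOn (vertex m q τ) (Set.Iio (7 * m + 2 + q)) := by
  intro k hk l hl h
  by_contra hne
  rcases lt_or_gt_of_ne hne with hlt | hlt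
  · exact (isEdge_vertex m τ hk).start_ne hq (isEdge_vertex m τ hl) hlt h
  · exact (isEdge_vertex m τ hl).start_ne hq (isEdge_vertex m τ hk) hlt h.symm

lemma blockPolygon_injective (hq : 2 ≤ q) : Function.Injective (blockPolygon m q τ).vertices :=
  fun k l h => Fin.ext (vertex_injOn hq k.isLt l.isLt (toPlane_injective h))

lemma isSimple_blockPolygon (hq : 2 ≤ q) (hq' : q ≤ 8) (hm : 0 < m) :
    IsSimple (blockPolygon m q τ) := by
  refine ⟨by omega, blockPolygon_injective hq, fun k l hkl => ?_⟩
  rw [edgeSet_blockPolygon hq, edgeSet_blockPolygon hq, blockPolygon_finRotate hq,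
    blockPolygon_finRotate hq, blockPolygon_apply, blockPolygon_apply]
  rcases lt_or_gt_of_ne (Fin.val_ne_of_ne hkl) with h | h
  · exact (isEdge_vertex m τ k.isLt).noCross hq hq' (isEdge_vertex m τ l.isLt) h
  · exact ((isEdge_vertex m τ l.isLt).noCross hq hq' (isEdge_vertex m τ k.isLt) h).symm

/-- Each `order t` is a permutation, so the type of a path affects only the numbering of the points
in its block. -/
lemma exists_vertex_eq (τ' : ℕ → Fin 6) {k : ℕ} (hk : k < 7 * m + 2 + q) :
    ∃ l < 7 * m + 2 + q, vertex m q τ' l = vertex m q τ k := by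
  by_cases h : k = 0 ∨ 7 * m < k
  · refine ⟨k, hk, ?_⟩
    rcases h with rfl | h
    · rw [vertex_zero, vertex_zero]
    · simp only [vertex, if_neg (show k ≠ 0 by omega), if_neg (show ¬ k ≤ 7 * m by omega)]
  · obtain ⟨i, hi⟩ : ∃ i, i = (k - 1) / 7 := ⟨_, rfl⟩
    obtain ⟨j, hj⟩ : ∃ j : Fin 7, k = 7 * i + 1 + j :=
      ⟨⟨(k - 1) % 7, by omega⟩, by simp only; omega⟩
    have him : i < m := by omega
    obtain ⟨j', hj'⟩ := (order_bijective (τ' i)).surjective (order (τ i) j)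
    refine ⟨7 * i + 1 + j', by omega, ?_⟩
    rw [hj, vertex_block q τ him, vertex_block q τ' him, pathPoint, pathPoint, hj']

lemma range_blockPolygon (τ τ' : ℕ → Fin 6) :
    Set.range (blockPolygon m q τ).vertices = Set.range (blockPolygon m q τ').vertices := by
  have h (τ τ' : ℕ → Fin 6) :
      Set.range (blockPolygon m q τ).vertices ⊆ Set.range (blockPolygon m q τ').vertices := by
    rintro _ ⟨k, rfl⟩
    obtain ⟨l, hl, h⟩ := exists_vertex_eq (τ := τ) τ' k.isLt
    exact ⟨⟨l, hl⟩, congrArg toPlane h⟩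
  exact (h τ τ').antisymm (h τ' τ)

lemma isCompact_boundary {n : ℕ} (poly : Polygon Plane n) : IsCompact (poly.boundary ℝ) := by
  refine isCompact_iUnion fun k => ?_
  rw [Polygon.edgeSet, affineSegment_eq_segment]
  exact isCompact_segment _ _

/-! ### Visibility of the tips -/

lemma IsEdge.disjoint_ray {i : ℕ} (hi : i < m) {e : Fin 6 × Fin 5 × ℤ × ℤ} (he : e ∈ tips)
    (hτ : τ i = e.1) (hq : 2 ≤ q) {k : ℕ} {p p' : ℤ × ℤ} (h : IsEdge m q τ k p p') :
    Disjoint (ray (toPlane (shift e.2.2 (spacing * (i + 1)))))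
      (segment ℝ (toPlane p) (toPlane p')) := by
  have hw := waypoint_bounds e he
  have left {p p' : ℤ × ℤ} (h : p.1 < spacing * (i + 1)) (h' : p'.1 < spacing * (i + 1)) :
      ClearAbove (shift e.2.2 (spacing * (i + 1))) p p' := by
    refine Or.inl ⟨?_, ?_⟩ <;> simp only [shift_fst] <;> omega
  have right {p p' : ℤ × ℤ} (h : spacing * (i + 1) + 40 < p.1)
      (h' : spacing * (i + 1) + 40 < p'.1) :
      ClearAbove (shift e.2.2 (spacing * (i + 1))) p p' := by
    refine Or.inr (Or.inl ⟨?_, ?_⟩) <;> simp only [shift_fst] <;> omega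
  cases h with
  | inner i' j' hi' =>
    have h1 := pathPoint_bounds (τ i') j'.castSucc
    have h2 := pathPoint_bounds (τ i') j'.succ
    rcases lt_trichotomy i' i with h | rfl | h
    · refine (left ?_ ?_).disjoint <;> simp only [shift_fst, spacing] <;> omega
    · rw [hτ]
      exact ((clear_inner e he j').shift _).disjoint
    · refine (right ?_ ?_).disjoint <;> simp only [shift_fst, spacing] <;> omega
  | link i' hi' =>
    have h1 := lastPoint_bounds (gate m τ i')
    have h2 := firstPoint_bounds (gate m τ (i' + 1))
    rcases lt_or_ge i' i with h | h
    · refine (left ?_ ?_).disjoint <;> simp only [shift_fst, spacing] <;> omega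
    · rcases h.eq_or_lt with rfl | h
      · rw [incoming_eq, gate_succ τ hi, hτ]
        exact ((clear_incoming e he _).shift _).disjoint
      · rcases (show i + 1 ≤ i' from h).eq_or_lt with rfl | h
        · rw [outgoing_eq, gate_succ τ hi, hτ]
          push_cast
          exact ((clear_outgoing e he _).shift _).disjoint
        · refine (right ?_ ?_).disjoint <;> simp only [shift_fst, spacing] <;> omega
  | drop => refine (right ?_ ?_).disjoint <;> simp only [spacing] <;> omega
  | floor =>
    refine disjoint_ray_segment 0 1 0 zero_le_one ?_ ?_ ?_ <;> simp only [shift_snd] <;> omega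
  | column s hs hsq => refine (left ?_ ?_).disjoint <;> simp only [spacing] <;> omega

lemma IsEdge.disjoint_leg {i : ℕ} (hi : i < m) {e : Fin 6 × Fin 5 × ℤ × ℤ} (he : e ∈ tips)
    (hτ : τ i = e.1) (hq : 2 ≤ q) {k : ℕ} {p p' : ℤ × ℤ} (h : IsEdge m q τ k p p')
    (hk : k ≠ 7 * i + 1 + e.2.1) (hk' : k ≠ 7 * i + 2 + e.2.1) :
    Disjoint (segment ℝ (toPlane (shift (tipPoint e.1 e.2.1) (spacing * (i + 1))))
      (toPlane (shift e.2.2 (spacing * (i + 1))))) (segment ℝ (toPlane p) (toPlane p')) := by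
  have hw := waypoint_bounds e he
  have hb : 0 ≤ (tipPoint e.1 e.2.1).1 ∧ (tipPoint e.1 e.2.1).1 ≤ 36 ∧
      0 ≤ (tipPoint e.1 e.2.1).2 ∧ (tipPoint e.1 e.2.1).2 ≤ 39 := pathPoint_bounds _ _
  have left {p p' : ℤ × ℤ} (h : p.1 < spacing * (i + 1)) (h' : p'.1 < spacing * (i + 1)) :
      Disjoint (segment ℝ (toPlane (shift (tipPoint e.1 e.2.1) (spacing * (i + 1))))
        (toPlane (shift e.2.2 (spacing * (i + 1))))) (segment ℝ (toPlane p) (toPlane p')) := by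
    refine (disjoint_segment_of_lt 1 0 (spacing * (i + 1)) ?_ ?_ ?_ ?_).symm <;>
      (try simp only [shift_fst]) <;> omega
  have right {p p' : ℤ × ℤ} (h : spacing * (i + 1) + 40 < p.1)
      (h' : spacing * (i + 1) + 40 < p'.1) :
      Disjoint (segment ℝ (toPlane (shift (tipPoint e.1 e.2.1) (spacing * (i + 1))))
        (toPlane (shift e.2.2 (spacing * (i + 1))))) (segment ℝ (toPlane p) (toPlane p')) := by
    refine disjoint_segment_of_lt 1 0 (spacing * (i + 1) + 41) ?_ ?_ ?_ ?_ <;>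
      (try simp only [shift_fst]) <;> omega
  cases h with
  | inner i' j' hi' =>
    have h1 := pathPoint_bounds (τ i') j'.castSucc
    have h2 := pathPoint_bounds (τ i') j'.succ
    rcases lt_trichotomy i' i with h | rfl | h
    · refine left ?_ ?_ <;> simp only [shift_fst, spacing] <;> omega
    · rw [hτ]
      refine ((leg_inner e he j' ?_ ?_).shift _).disjoint
      · rintro rfl
        exact hk rfl
      · rintro rfl
        exact hk' (by simp only [Fin.val_succ]; omega)
    · refine right ?_ ?_ <;> simp only [shift_fst, spacing] <;> omega
  | link i' hi' =>
    have h1 := lastPoint_bounds (gate m τ i')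
    have h2 := firstPoint_bounds (gate m τ (i' + 1))
    rcases lt_or_ge i' i with h | h
    · refine left ?_ ?_ <;> simp only [shift_fst, spacing] <;> omega
    · rcases h.eq_or_lt with rfl | h
      · rw [incoming_eq, gate_succ τ hi, hτ]
        exact ((leg_incoming e he _).shift _).disjoint
      · rcases (show i + 1 ≤ i' from h).eq_or_lt with rfl | h
        · rw [outgoing_eq, gate_succ τ hi, hτ]
          push_cast
          exact ((leg_outgoing e he _).shift _).disjoint
        · refine right ?_ ?_ <;> simp only [shift_fst, spacing] <;> omega
  | drop => refine right ?_ ?_ <;> simp only [spacing] <;> omega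
  | floor =>
    refine (disjoint_segment_of_lt 0 1 0 ?_ ?_ ?_ ?_).symm <;> simp only [shift_snd] <;> omega
  | column s hs hsq => refine left ?_ ?_ <;> simp only [spacing] <;> omega

/-- The claim concerns only the starting vertex `p`; the edge serves to locate it. Other points of
the block are excluded by `cone_block`, everything else by its horizontal distance. -/
lemma IsEdge.exists_coneNormal {i : ℕ} (hi : i < m) {e : Fin 6 × Fin 5 × ℤ × ℤ} (he : e ∈ tips)
    (hτ : τ i = e.1) (hq' : q ≤ 8) {k : ℕ} {p p' : ℤ × ℤ} (h : IsEdge m q τ k p p')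
    (h0 : k ≠ 7 * i + 1 + e.2.1) (h1 : k ≠ 7 * i + 2 + e.2.1) (h2 : k ≠ 7 * i + 3 + e.2.1) :
    ∃ v ∈ coneNormals e.1 e.2.1, v.1 * p.1 + v.2 * p.2 <
      v.1 * (shift (tipPoint e.1 e.2.1) (spacing * (i + 1))).1 +
        v.2 * (shift (tipPoint e.1 e.2.1) (spacing * (i + 1))).2 := by
  have hb : 0 ≤ (tipPoint e.1 e.2.1).1 ∧ (tipPoint e.1 e.2.1).1 ≤ 36 ∧
      0 ≤ (tipPoint e.1 e.2.1).2 ∧ (tipPoint e.1 e.2.1).2 ≤ 39 := pathPoint_bounds _ _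
  -- The vertical term is at most `40 * 500 = 20000`, far less than the horizontal 900000. As `q ≤
  -- 8`, no vertex is lower than `20 - 40 * 8 = -300`.
  have far {v : ℤ × ℤ} (hv : v ∈ coneNormals e.1 e.2.1) (p : ℤ × ℤ) (hy : |p.2| ≤ 400)
      (hx : v.1 * (p.1 - (shift (tipPoint e.1 e.2.1) (spacing * (i + 1))).1) ≤ -900000) :
      ∃ v ∈ coneNormals e.1 e.2.1, v.1 * p.1 + v.2 * p.2 <
        v.1 * (shift (tipPoint e.1 e.2.1) (spacing * (i + 1))).1 +
        v.2 * (shift (tipPoint e.1 e.2.1) (spacing * (i + 1))).2 := by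
    refine ⟨v, hv, ?_⟩
    have hv2 := (cone_neighbours e he v hv).2.2.2
    have hd : |p.2 - (tipPoint e.1 e.2.1).2| ≤ 500 := by
      rw [abs_le] at hy ⊢
      omega
    have := (le_abs_self _).trans
      ((abs_mul v.2 (p.2 - (tipPoint e.1 e.2.1).2)).le.trans
        (mul_le_mul hv2 hd (abs_nonneg _) (by norm_num)))
    rw [shift_snd]
    linarith
  have left (p : ℤ × ℤ) (hy : -400 ≤ p.2 ∧ p.2 ≤ 400) (hx : p.1 ≤ spacing * (i + 1) - 900000) :
      ∃ v ∈ coneNormals e.1 e.2.1, v.1 * p.1 + v.2 * p.2 <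
        v.1 * (shift (tipPoint e.1 e.2.1) (spacing * (i + 1))).1 +
        v.2 * (shift (tipPoint e.1 e.2.1) (spacing * (i + 1))).2 := by
    obtain ⟨v, hv, hv'⟩ := cone_left e he
    refine far hv p (abs_le.2 hy) ?_
    have : p.1 - (shift (tipPoint e.1 e.2.1) (spacing * (i + 1))).1 ≤ -900000 := by
      rw [shift_fst]; omega
    nlinarith
  have right (p : ℤ × ℤ) (hy : -400 ≤ p.2 ∧ p.2 ≤ 400)
      (hx : spacing * (i + 1) + 900100 ≤ p.1) :
      ∃ v ∈ coneNormals e.1 e.2.1, v.1 * p.1 + v.2 * p.2 <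
        v.1 * (shift (tipPoint e.1 e.2.1) (spacing * (i + 1))).1 +
        v.2 * (shift (tipPoint e.1 e.2.1) (spacing * (i + 1))).2 := by
    obtain ⟨v, hv, hv'⟩ := cone_right e he
    refine far hv p (abs_le.2 hy) ?_
    have : 900000 ≤ p.1 - (shift (tipPoint e.1 e.2.1) (spacing * (i + 1))).1 := by
      rw [shift_fst]; omega
    nlinarith
  have block (j : Fin 7) (h0 : j.val ≠ e.2.1) (h1 : j.val ≠ e.2.1 + 1) (h2 : j.val ≠ e.2.1 + 2) :
      ∃ v ∈ coneNormals e.1 e.2.1,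
        v.1 * (shift (pathPoint e.1 j) (spacing * (i + 1))).1 +
          v.2 * (shift (pathPoint e.1 j) (spacing * (i + 1))).2 <
        v.1 * (shift (tipPoint e.1 e.2.1) (spacing * (i + 1))).1 +
          v.2 * (shift (tipPoint e.1 e.2.1) (spacing * (i + 1))).2 := by
    have hinj := (order_bijective e.1).injective
    obtain ⟨v, hv, hv'⟩ := cone_block e he (order e.1 j)
      (fun h => h0 (by rw [hinj h]; rfl)) (fun h => h1 (by rw [hinj h]; rfl))
      (fun h => h2 (by rw [hinj h]; rfl))
    refine ⟨v, hv, ?_⟩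
    simp only [shift_fst, shift_snd, pathPoint] at hv' ⊢
    linarith
  cases h with
  | inner i' j' hi' =>
    have h1 := pathPoint_bounds (τ i') j'.castSucc
    rcases lt_trichotomy i' i with h | rfl | h
    · refine left _ ?_ ?_ <;> simp only [shift_fst, shift_snd, spacing] <;> omega
    · rw [hτ]
      refine block _ ?_ ?_ ?_ <;> simp only [Fin.val_castSucc] <;> omega
    · refine right _ ?_ ?_ <;> simp only [shift_fst, shift_snd, spacing] <;> omega
  | link i' hi' =>
    have h1 := lastPoint_bounds (gate m τ i')
    -- Link `i'` starts at the last point of block `i' - 1`, so block `i` itself is the case `i' = i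
    -- + 1`.
    rcases lt_trichotomy i' (i + 1) with h | rfl | h
    · refine left _ ?_ ?_ <;> simp only [shift_fst, shift_snd, spacing] <;> omega
    · rw [gate_succ τ hi, hτ]
      push_cast
      refine block 6 ?_ ?_ ?_ <;> simp only [show ((6 : Fin 7) : ℕ) = 6 from rfl] <;> omega
    · refine right _ ?_ ?_ <;> simp only [shift_fst, shift_snd, spacing] <;> omega
  | drop => refine right _ ?_ ?_ <;> simp only [spacing] <;> omega
  | floor => refine right _ ?_ ?_ <;> simp only [spacing] <;> omega
  | column s hs hsq => refine left _ ?_ ?_ <;> simp only [spacing] <;> omega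

/-- A tip of the polygon is seen from no vertices but itself and its two neighbours. -/
theorem not_segment_tip_subset_region (hq : 2 ≤ q) (hq' : q ≤ 8) {i : ℕ} (hi : i < m)
    {e : Fin 6 × Fin 5 × ℤ × ℤ} (he : e ∈ tips) (hτ : τ i = e.1) {k : ℕ}
    (hk : k < 7 * m + 2 + q) (h0 : k ≠ 7 * i + 1 + e.2.1) (h1 : k ≠ 7 * i + 2 + e.2.1)
    (h2 : k ≠ 7 * i + 3 + e.2.1) :
    ¬ segment ℝ (toPlane (vertex m q τ k)) (toPlane (vertex m q τ (7 * i + 2 + e.2.1))) ⊆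
      region (blockPolygon m q τ) := by
  obtain ⟨v, hv, hlt⟩ := (isEdge_vertex m τ hk).exists_coneNormal hi he hτ hq' h0 h1 h2
  obtain ⟨hprev, hnext, hway, -⟩ := cone_neighbours e he v hv
  have hvert (j : Fin 7) (n : ℕ) (hn : n = 7 * i + 1 + j) :
      vertex m q τ n = shift (pathPoint e.1 j) (spacing * (i + 1)) := by
    rw [hn, vertex_block q τ hi, hτ]
  have hb : vertex m q τ (7 * i + 2 + e.2.1) =
      shift (tipPoint e.1 e.2.1) (spacing * (i + 1)) :=
    hvert _ _ (by simp only [Fin.val_castSucc, Fin.val_succ]; omega)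
  have ha : vertex m q τ (7 * i + 1 + e.2.1) =
      shift (prevPoint e.1 e.2.1) (spacing * (i + 1)) :=
    hvert _ _ (by simp only [Fin.val_castSucc])
  have hd : vertex m q τ (7 * i + 3 + e.2.1) =
      shift (nextPoint e.1 e.2.1) (spacing * (i + 1)) :=
    hvert _ _ (by simp only [Fin.val_succ]; omega)
  rw [hb]
  have hboundary : (blockPolygon m q τ).boundary ℝ = ⋃ k : Fin (7 * m + 2 + q),
      segment ℝ (toPlane (vertex m q τ k)) (toPlane (vertex m q τ (k + 1))) :=
    Set.iUnion_congr fun k => edgeSet_blockPolygon hq k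
  -- `F₁` is the half-plane containing the two edges at the tip, `F₂` the union of all other edges.
  refine not_segment_subset_region (blockPolygon m q τ)
    (w := toPlane (shift e.2.2 (spacing * (i + 1))))
    (F₁ := {z | functional v.1 v.2 (toPlane (shift (tipPoint e.1 e.2.1) (spacing * (i + 1)))) ≤
      functional v.1 v.2 z})
    (F₂ := ⋃ k : Fin (7 * m + 2 + q),
      ⋃ (_ : k.val ≠ 7 * i + 1 + e.2.1 ∧ k.val ≠ 7 * i + 2 + e.2.1),
      segment ℝ (toPlane (vertex m q τ k)) (toPlane (vertex m q τ (k + 1))))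
    (α := v.1) (β := v.2) ?_ (isCompact_boundary _) ?_ (fun z hz => hz) ?_ ?_ ?_ ?_
  · rw [hboundary]
    refine Set.iUnion_subset fun k => ?_
    by_cases hk0 : k.val = 7 * i + 1 + e.2.1
    · refine fun z hz => Or.inl (le_functional_of_mem_segment hz ?_ ?_)
      · rw [hk0, ha, functional_toPlane, functional_toPlane]
        norm_cast
        simp only [shift_fst, shift_snd]
        linarith
      · rw [hk0, show 7 * i + 1 + e.2.1.val + 1 = 7 * i + 2 + e.2.1 by ring, hb]
    by_cases hk1 : k.val = 7 * i + 2 + e.2.1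
    · refine fun z hz => Or.inl (le_functional_of_mem_segment hz ?_ ?_)
      · rw [hk1, hb]
      · rw [hk1, show 7 * i + 2 + e.2.1.val + 1 = 7 * i + 3 + e.2.1 by ring, hd,
          functional_toPlane, functional_toPlane]
        norm_cast
        simp only [shift_fst, shift_snd]
        linarith
    · exact fun z hz => Or.inr (Set.mem_iUnion₂.2 ⟨k, ⟨hk0, hk1⟩, hz⟩)
  · exact isClosed_iUnion_of_finite fun k =>
      isClosed_iUnion_of_finite fun _ => (isCompact_segment _ _).isClosed
  · rw [functional_toPlane, functional_toPlane]
    exact_mod_cast hlt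
  · rw [functional_toPlane, functional_toPlane]
    norm_cast
    simp only [shift_fst, shift_snd]
    linarith
  · simp only [Set.disjoint_iUnion_right]
    exact fun k hk => (isEdge_vertex m τ k.isLt).disjoint_leg hi he hτ hq hk.1 hk.2
  · rw [hboundary, Set.disjoint_iUnion_right]
    exact fun k => (isEdge_vertex m τ k.isLt).disjoint_ray hi he hτ hq

end

/-! ### Counting guards -/

/-- The vertices of the polygons `blockPolygon m q τ`. -/
noncomputable def vertexSet (m q : ℕ) : Finset Plane :=
  (Set.finite_range (blockPolygon m q fun _ => 0).vertices).toFinset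

/-- The point with number `a` in the `i`-th block. -/
noncomputable def pointOfBlock (i : ℕ) (a : Fin 7) : Plane :=
  toPlane (shift (blockPoint a) (spacing * (i + 1)))

lemma pointOfBlock_injective {i i' : ℕ} {a a' : Fin 7}
    (h : pointOfBlock i a = pointOfBlock i' a') : i = i' ∧ a = a' := by
  have h := toPlane_injective h
  have h1 := congrArg Prod.fst h
  have h2 := congrArg Prod.snd h
  have hb := blockPoint_bounds a
  have hb' := blockPoint_bounds a'
  simp only [shift_fst, shift_snd, spacing] at h1 h2
  obtain rfl : i = i' := by omega
  exact ⟨rfl, blockPoint_injective (Prod.ext (by simpa using h1) h2)⟩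

section

variable {m q : ℕ} {τ : ℕ → Fin 6}

lemma coe_vertexSet (τ : ℕ → Fin 6) :
    (vertexSet m q : Set Plane) = Set.range (blockPolygon m q τ).vertices := by
  rw [vertexSet, Set.Finite.coe_toFinset, range_blockPolygon _ τ]

lemma card_vertexSet (hq : 2 ≤ q) : (vertexSet m q).card = 7 * m + 2 + q := by
  rw [← Set.ncard_coe_finset, coe_vertexSet (fun _ => 0),
    ← Set.image_univ, Set.ncard_image_of_injective _ (blockPolygon_injective hq), Set.ncard_univ,
    Nat.card_eq_fintype_card, Fintype.card_fin]

lemma region_mem_simplePolygons (hq : 2 ≤ q) (hq' : q ≤ 8) (hm : 0 < m) (τ : ℕ → Fin 6) :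
    region (blockPolygon m q τ) ∈ simplePolygons (vertexSet m q) :=
  ⟨_, blockPolygon m q τ, isSimple_blockPolygon hq hq' hm, (coe_vertexSet τ).symm, rfl⟩

lemma toPlane_vertex {i : ℕ} (hi : i < m) (j : Fin 7) {k : ℕ} (hk : k = 7 * i + 1 + j) :
    toPlane (vertex m q τ k) = pointOfBlock i (order (τ i) j) := by
  rw [hk, vertex_block q τ hi]
  rfl

lemma segment_subset_region (hq : 2 ≤ q) {k : ℕ} (hk : k < 7 * m + 2 + q) :
    segment ℝ (toPlane (vertex m q τ k)) (toPlane (vertex m q τ (k + 1))) ⊆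
      region (blockPolygon m q τ) := by
  have := edgeSet_blockPolygon (τ := τ) hq ⟨k, hk⟩
  simp only at this
  rw [← this]
  exact (Set.subset_iUnion (fun k => (blockPolygon m q τ).edgeSet ℝ k) ⟨k, hk⟩).trans
    Set.subset_union_left

/-- The guard condition is used only for the tip itself, which is a point of the region. -/
lemma mem_of_isGuardSet (hq : 2 ≤ q) (hq' : q ≤ 8) {i : ℕ} (hi : i < m)
    {e : Fin 6 × Fin 5 × ℤ × ℤ} (he : e ∈ tips) (hτ : τ i = e.1) {G : Finset Plane}
    (hG : G ⊆ vertexSet m q) (hguard : IsGuardSet G (region (blockPolygon m q τ))) :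
    pointOfBlock i (order e.1 e.2.1.castSucc.castSucc) ∈ G ∨
      pointOfBlock i (order e.1 e.2.1.succ.castSucc) ∈ G ∨
      pointOfBlock i (order e.1 e.2.1.succ.succ) ∈ G := by
  have hj := e.2.1.isLt
  have hb : toPlane (vertex m q τ (7 * i + 2 + e.2.1)) ∈ region (blockPolygon m q τ) :=
    segment_subset_region hq (by omega) (left_mem_segment ℝ _ _)
  rw [← (show ⋃ g ∈ G, _ = _ from hguard)] at hb
  obtain ⟨g, hg, -, hsub⟩ := Set.mem_iUnion₂.1 hb
  have hg' : g ∈ (vertexSet m q : Set Plane) := hG hg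
  rw [coe_vertexSet τ] at hg'
  obtain ⟨k, rfl⟩ := hg'
  change toPlane (vertex m q τ k) ∈ G at hg
  rw [← hτ]
  by_cases h0 : k.val = 7 * i + 1 + e.2.1
  · exact Or.inl (by rwa [← toPlane_vertex hi _ (by simpa using h0)])
  by_cases h1 : k.val = 7 * i + 2 + e.2.1
  · refine Or.inr (Or.inl ?_)
    rwa [← toPlane_vertex hi e.2.1.succ.castSucc (k := k)
      (by simp only [Fin.val_castSucc, Fin.val_succ]; omega)]
  by_cases h2 : k.val = 7 * i + 3 + e.2.1
  · refine Or.inr (Or.inr ?_)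
    rwa [← toPlane_vertex hi e.2.1.succ.succ (k := k) (by simp only [Fin.val_succ]; omega)]
  exact absurd hsub (not_segment_tip_subset_region hq hq' hi he hτ k.isLt h0 h1 h2)

lemma four_mul_le_card (hq : 2 ≤ q) (hq' : q ≤ 8) {G : Finset Plane} (hG : G ⊆ vertexSet m q)
    (hguard : ∀ t : Fin 6, IsGuardSet G (region (blockPolygon m q fun _ => t))) :
    4 * m ≤ G.card := by
  classical
  let s (i : ℕ) : Finset (Fin 7) := Finset.univ.filter fun a => pointOfBlock i a ∈ G
  have hs (i : ℕ) (hi : i < m) : 4 ≤ (s i).card := by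
    refine four_le_card_of_hits _ fun e he => ?_
    simpa [s] using mem_of_isGuardSet (τ := fun _ => e.1) hq hq' hi he rfl hG (hguard e.1)
  calc 4 * m = ∑ i ∈ Finset.range m, 4 := by simp [mul_comm]
    _ ≤ ∑ i ∈ Finset.range m, (s i).card :=
      Finset.sum_le_sum fun i hi => hs i (Finset.mem_range.1 hi)
    _ = ((Finset.range m).sigma s).card := (Finset.card_sigma _ _).symm
    _ ≤ G.card := by
      refine Finset.card_le_card_of_injOn (fun x => pointOfBlock x.1 x.2) ?_ ?_
      · intro x hx
        have hx : x ∈ (Finset.range m).sigma s := hx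
        exact (Finset.mem_filter.1 (Finset.mem_sigma.1 hx).2).2
      · rintro ⟨i, a⟩ - ⟨i', a'⟩ - h
        obtain ⟨rfl, rfl⟩ := pointOfBlock_injective h
        rfl

end

/-! ### Many polygons with the same vertices -/

/-- A choice between the first two paths in each block. -/
def binaryTypes {m : ℕ} (c : Fin m → Bool) (i : ℕ) : Fin 6 :=
  if h : i < m then (if c ⟨i, h⟩ then 1 else 0) else 0

/-- Where two choices differ, points 6 and 1 of the block see each other along an edge of path 1,
but not in the polygon using path 0, where 6 is a tip with neighbours 5 and 0. -/
lemma region_binaryTypes_injective {m q : ℕ} (hq : 2 ≤ q) (hq' : q ≤ 8) :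
    Function.Injective fun c : Fin m → Bool => region (blockPolygon m q (binaryTypes c)) := by
  have key (c c' : Fin m → Bool) (i : Fin m) (hc : c i = false) (hc' : c' i = true) :
      region (blockPolygon m q (binaryTypes c)) ≠ region (blockPolygon m q (binaryTypes c')) := by
    intro h
    have hi := i.isLt
    have h0 : binaryTypes c i = 0 := by simp [binaryTypes, hc]
    have h1 : binaryTypes c' i = 1 := by simp [binaryTypes, hc']
    have hsee := segment_subset_region (τ := binaryTypes c') hq
      (show 7 * i.val + 1 < 7 * m + 2 + q by omega)
    rw [toPlane_vertex hi 0 (k := 7 * i + 1) rfl, toPlane_vertex hi 1 (k := 7 * i + 1 + 1) rfl, h1,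
      ← h, segment_symm] at hsee
    refine not_segment_tip_subset_region hq hq' hi (e := (0, 0, 4, 28)) (by decide) h0
      (k := 7 * i + 4) (by omega) ?_ ?_ ?_ ?_
    · simp
    · simp
    · simp
    · rw [toPlane_vertex hi 3 (k := 7 * i + 4) rfl,
        toPlane_vertex hi 1 (k := 7 * i + 2 + (0 : Fin 5).val) rfl, h0]
      exact hsee
  intro c c' h
  by_contra hne
  obtain ⟨i, hi⟩ := Function.ne_iff.1 hne
  rcases hc : c i with _ | _ <;> rcases hc' : c' i with _ | _
  · exact hi (hc.trans hc'.symm)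
  · exact key c c' i hc hc' h
  · exact key c' c i hc' hc h.symm
  · exact hi (hc.trans hc'.symm)

/-- For `k` between `6` and `2 ^ m` there are `k` polygons on the set `vertexSet m q` that need
`4 * m` guards. -/
theorem exists_polygons {m q k : ℕ} (hq : 2 ≤ q) (hq' : q ≤ 8) (hm : 0 < m) (hk : 6 ≤ k)
    (hkm : k ≤ 2 ^ m) : ∃ A : Finset (Set Plane), A.card = k ∧
      (A : Set (Set Plane)) ⊆ simplePolygons (vertexSet m q) ∧
      ((4 * m : ℕ) : ℕ∞) ≤ guardNumber (vertexSet m q) A := by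
  classical
  let B : Finset (Set Plane) :=
    Finset.univ.image fun t : Fin 6 => region (blockPolygon m q fun _ => t)
  let C : Finset (Set Plane) :=
    Finset.univ.image fun c : Fin m → Bool => region (blockPolygon m q (binaryTypes c))
  have hB : B.card ≤ k := Finset.card_image_le.trans (by simpa using hk)
  -- The six polygons in `B` need not be shown distinct: `C` alone has `2 ^ m` elements, enough to
  -- enlarge `B` to exactly `k`.
  have hC : k ≤ (B ∪ C).card := by
    refine le_trans ?_ (Finset.card_le_card Finset.subset_union_right)
    rw [Finset.card_image_of_injective _ (region_binaryTypes_injective hq hq')]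
    simpa using hkm
  obtain ⟨A, hBA, hA, hcard⟩ :=
    Finset.exists_subsuperset_card_eq Finset.subset_union_left hB hC
  refine ⟨A, hcard, fun P hP => ?_, le_iInf₂ fun G hG => ?_⟩
  · rcases Finset.mem_union.1 (hA hP) with h | h <;>
      obtain ⟨x, -, rfl⟩ := Finset.mem_image.1 h <;>
      exact region_mem_simplePolygons hq hq' hm _
  · exact_mod_cast four_mul_le_card hq hq' hG.1 fun t =>
      hG.2 _ (hBA (Finset.mem_image_of_mem _ (Finset.mem_univ t)))

end UniversalGuard

theorem mainTheorem12 :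
    ∃ N : ℕ, ∀ k : ℕ, 6 ≤ k → ∀ n : ℕ, N ≤ n → k ≤ n →
      ((5 * n / 9 : ℕ) : ℕ∞) ≤ UniversalGuard.kUniversalGuardNumber k n := by
  -- With `n ≤ 7 * m + 10` the final inequality follows from `35 * m + 50 < 36 * m + 9`, that is `m
  -- > 41`; 400 points ensure `m ≥ 56`.
  refine ⟨400, fun k hk n hn hkn => ?_⟩
  obtain ⟨m, q, hq, hq', rfl⟩ : ∃ m q, 2 ≤ q ∧ q ≤ 8 ∧ n = 7 * m + 2 + q :=
    ⟨(n - 4) / 7, 2 + (n - 4) % 7, by omega, by omega, by omega⟩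
  -- This is where `k ≤ n` enters: `n` is linear in `m`.
  have hpow : k ≤ 2 ^ m := by
    obtain ⟨a, rfl⟩ : ∃ a, m = a + 10 := ⟨m - 10, by omega⟩
    have := Nat.lt_two_pow_self (n := a)
    rw [pow_add]
    omega
  obtain ⟨A, hA, hsimple, hguard⟩ :=
    UniversalGuard.exists_polygons (q := q) hq hq' (by omega : 0 < m) hk hpow
  calc ((5 * (7 * m + 2 + q) / 9 : ℕ) : ℕ∞) ≤ ((4 * m : ℕ) : ℕ∞) := by
        exact_mod_cast (by omega : 5 * (7 * m + 2 + q) / 9 ≤ 4 * m)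
    _ ≤ UniversalGuard.guardNumber (UniversalGuard.vertexSet m q) A := hguard
    _ ≤ UniversalGuard.kUniversalGuardNumber k (7 * m + 2 + q) :=
      le_iSup₂_of_le (UniversalGuard.vertexSet m q) (UniversalGuard.card_vertexSet hq)
        (le_iSup₂_of_le A ⟨hA, hsimple⟩ le_rfl)
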